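/- Let $M$ be a spacetime, i.e. a smooth (Hausdorff, second countable) $n$-dimensional manifold with a smooth Lorentzian metric $g$ of signature $(1,n-1)$ (timelike vectors being those with $g(v,v)<0$) and a time-orientation, that is, a continuous choice of one of the two components of the timelike vectors in each tangent space. For $p\in M$ let $I^{+}(p)$ and $I^-(p)$ be the sets of points that can be reached from $p$, respectively from which $p$ can be reached, by a future-directed timelike (piecewise $C^1$) curve, and let $J^{\pm}(p)$ be the analogous sets for causal curves, with $p\in J^\pm(p)$. Assume that $M$ is globally hyperbolic: $M$ is strongly causal (every neighborhood of a point contains a causally convex neighborhood of that point, a set $V$ being causally convex if every causal curve joining two points of $V$ stays in $V$), and $J^-(p)\cap J^+(q)$ is compact for all $p,q\in M$. A past open set is an open set $U\subset M$ with $I^-(x)\subset U$ for all $x\in U$. An indecomposable past set (IP) is a nonempty past open set $P$ that is not the union of two past open sets both different from $P$; a proper one (PIP) is an IP of the form $I^-(p)$ with $p\in M$. Let $\hat M$ be the set of IPs. For $U$ of the form $I^+(p)$ or $M\setminus J^-(p)$, let $\mathcal O_U=\{P\in\hat M: P\cap U\neq\emptyset\}$; for $U$ of the form $I^-(p)$ or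 $M\setminus J^+(p)$, let $\mathcal O'_U=\{P\in\hat M:\overline P\subset U\}$. Let $\tau$ be the topology on $\hat M$ generated by all these sets $\mathcal O_U$ and $\mathcal O'_U$. Then the finite intersections of the sets $\mathcal O_U$ and $\mathcal O'_U$ form a basis of $\tau$, the topology $\tau$ is Hausdorff, and the set of PIPs is an open dense subset of $(\hat M,\tau)$. -/

import Mathlib

open Set TopologicalSpace
open scoped Manifold ContDiff Topology Bundle

/-- A smooth Lorentzian metric on an `n`-dimensional manifold, of signature `(1, n - 1)` with timelike
vectors negative. -/
structure LorentzianMetric (n : ℕ) (M : Type*) [TopologicalSpace M]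
    [ChartedSpace (EuclideanSpace ℝ (Fin n)) M] [IsManifold (𝓡 n) ∞ M] where
  /-- The bilinear form on each tangent space. -/
  val (x : M) : TangentSpace (𝓡 n) x →L[ℝ] TangentSpace (𝓡 n) x →L[ℝ] ℝ
  symm (x : M) (v w : TangentSpace (𝓡 n) x) : val x v w = val x w v
  /-- There is a negative line whose orthogonal complement is positive definite. In particular the
  form is nondegenerate. -/
  signature (x : M) : ∃ u : TangentSpace (𝓡 n) x, val x u u < 0 ∧
    ∀ w : TangentSpace (𝓡 n) x, val x u w = 0 → w ≠ 0 → 0 < val x w w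
  contMDiff : ContMDiff (𝓡 n)
    ((𝓡 n).prod 𝓘(ℝ, EuclideanSpace ℝ (Fin n) →L[ℝ] EuclideanSpace ℝ (Fin n) →L[ℝ] ℝ)) ∞
    (fun x ↦ Bundle.TotalSpace.mk'
      (EuclideanSpace ℝ (Fin n) →L[ℝ] EuclideanSpace ℝ (Fin n) →L[ℝ] ℝ)
      (E := fun x : M ↦ TangentSpace (𝓡 n) x →L[ℝ] TangentSpace (𝓡 n) x →L[ℝ] ℝ) x (val x))

/-- A time-oriented Lorentzian manifold. -/
structure Spacetime (n : ℕ) (M : Type*) [TopologicalSpace M]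
    [ChartedSpace (EuclideanSpace ℝ (Fin n)) M] [IsManifold (𝓡 n) ∞ M] extends
    LorentzianMetric n M where
  /-- The chosen component of the set of timelike vectors at each point (the future cone). -/
  futureCone (x : M) : Set (TangentSpace (𝓡 n) x)
  /-- The component of the timelike vectors that contains a timelike vector `u` is
  `{v | g(v, v) < 0, g(u, v) < 0}`. -/
  isTimeCone (x : M) : ∃ u : TangentSpace (𝓡 n) x, val x u u < 0 ∧
    futureCone x = {v | val x v v < 0 ∧ val x u v < 0}
  /-- The choice is continuous: near every point it contains a continuous local vector field. -/
  continuousChoice (x : M) : ∃ U ∈ 𝓝 x, ∃ X : ∀ y : M, TangentSpace (𝓡 n) y,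
    ContinuousOn (fun y ↦ (⟨y, X y⟩ : TangentBundle (𝓡 n) M)) U ∧ ∀ y ∈ U, X y ∈ futureCone y

namespace Spacetime

variable {n : ℕ} {M : Type*} [TopologicalSpace M]
  [ChartedSpace (EuclideanSpace ℝ (Fin n)) M] [IsManifold (𝓡 n) ∞ M]

/-- Future-directed timelike tangent vectors. -/
def IsFutureTimelike (S : Spacetime n M) (x : M) (v : TangentSpace (𝓡 n) x) : Prop :=
  v ∈ S.futureCone x

/-- Future-directed causal tangent vectors: nonzero timelike or lightlike vectors in the closed half
determined by the future cone. -/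
def IsFutureCausal (S : Spacetime n M) (x : M) (v : TangentSpace (𝓡 n) x) : Prop :=
  v ≠ 0 ∧ S.val x v v ≤ 0 ∧ ∀ u ∈ S.futureCone x, S.val x u v < 0

/-- The velocity at time `t` of a curve defined on `[a, b]` (one-sided at `a` and at `b`). -/
noncomputable def velocity (n : ℕ) {M : Type*} [TopologicalSpace M]
    [ChartedSpace (EuclideanSpace ℝ (Fin n)) M] (γ : ℝ → M) (a b t : ℝ) :
    TangentSpace (𝓡 n) (γ t) :=
  mfderivWithin 𝓘(ℝ, ℝ) (𝓡 n) γ (Icc a b) t (1 : ℝ)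

/-- `γ` restricted to `[a, b]`, `a < b`, is a piecewise `C¹` future-directed timelike curve: a
concatenation of finitely many `C¹` curves with future-directed timelike velocity. -/
inductive IsTimelikeCurve (S : Spacetime n M) (γ : ℝ → M) : ℝ → ℝ → Prop
  | piece {a b : ℝ} (hab : a < b)
      (hγ : ContMDiffOn 𝓘(ℝ, ℝ) (𝓡 n) 1 γ (Icc a b))
      (hv : ∀ t ∈ Icc a b, S.IsFutureTimelike (γ t) (velocity n γ a b t)) :
      IsTimelikeCurve S γ a b
  | concat {a b c : ℝ} (h₁ : IsTimelikeCurve S γ a b) (h₂ : IsTimelikeCurve S γ b c) :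
      IsTimelikeCurve S γ a c

/-- `γ` restricted to `[a, b]`, `a < b`, is a piecewise `C¹` future-directed causal curve. -/
inductive IsCausalCurve (S : Spacetime n M) (γ : ℝ → M) : ℝ → ℝ → Prop
  | piece {a b : ℝ} (hab : a < b)
      (hγ : ContMDiffOn 𝓘(ℝ, ℝ) (𝓡 n) 1 γ (Icc a b))
      (hv : ∀ t ∈ Icc a b, S.IsFutureCausal (γ t) (velocity n γ a b t)) :
      IsCausalCurve S γ a b
  | concat {a b c : ℝ} (h₁ : IsCausalCurve S γ a b) (h₂ : IsCausalCurve S γ b c) :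
      IsCausalCurve S γ a c

/-- `p ≪ q`: a future-directed timelike curve goes from `p` to `q`. -/
def Chron (S : Spacetime n M) (p q : M) : Prop :=
  ∃ (γ : ℝ → M) (a b : ℝ), S.IsTimelikeCurve γ a b ∧ γ a = p ∧ γ b = q

/-- `p ≤ q`: `p = q` (the constant curve), or a future-directed causal curve goes from `p` to `q`. -/
def Causal (S : Spacetime n M) (p q : M) : Prop :=
  p = q ∨ ∃ (γ : ℝ → M) (a b : ℝ), S.IsCausalCurve γ a b ∧ γ a = p ∧ γ b = q

/-- The chronological future `I⁺(p)`. -/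
def chronFuture (S : Spacetime n M) (p : M) : Set M := {q | S.Chron p q}

/-- The chronological past `I⁻(p)`. -/
def chronPast (S : Spacetime n M) (p : M) : Set M := {q | S.Chron q p}

/-- The causal future `J⁺(p)`. -/
def causalFuture (S : Spacetime n M) (p : M) : Set M := {q | S.Causal p q}

/-- The causal past `J⁻(p)`. -/
def causalPast (S : Spacetime n M) (p : M) : Set M := {q | S.Causal q p}

/-- Every causal curve joining two points of `V` is contained in `V`. -/
def CausallyConvex (S : Spacetime n M) (V : Set M) : Prop :=
  ∀ (γ : ℝ → M) (a b : ℝ), S.IsCausalCurve γ a b → γ a ∈ V → γ b ∈ V → ∀ t ∈ Icc a b, γ t ∈ V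

/-- Every neighborhood of every point contains a causally convex neighborhood of that point. -/
def StronglyCausal (S : Spacetime n M) : Prop :=
  ∀ p : M, ∀ U ∈ 𝓝 p, ∃ V ∈ 𝓝 p, V ⊆ U ∧ S.CausallyConvex V

/-- Global hyperbolicity: strong causality and compactness of all causal diamonds. -/
def GloballyHyperbolic (S : Spacetime n M) : Prop :=
  S.StronglyCausal ∧ ∀ p q : M, IsCompact (S.causalPast p ∩ S.causalFuture q)

/-- Past open subsets: open sets `U` with `I⁻(U) ⊆ U`. -/
def IsPastSet (S : Spacetime n M) (U : Set M) : Prop :=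
  IsOpen U ∧ (⋃ p ∈ U, S.chronPast p) ⊆ U

/-- The indecomposable past sets of `M`: nonempty past open sets that are not the union of two
past open sets both different from the whole set. -/
structure IP (S : Spacetime n M) where
  /-- The underlying subset of `M`. -/
  carrier : Set M
  nonempty : carrier.Nonempty
  isPastSet : S.IsPastSet carrier
  indecomposable : ∀ V W : Set M, S.IsPastSet V → S.IsPastSet W → carrier = V ∪ W →
    V = carrier ∨ W = carrier

/-- The set `𝒪_U` of indecomposable past sets that meet `U`. -/
def meeting (S : Spacetime n M) (U : Set M) : Set S.IP := {P | (P.carrier ∩ U).Nonempty}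

/-- The set `𝒪'_U` of indecomposable past sets whose closure lies in `U`. -/
def inside (S : Spacetime n M) (U : Set M) : Set S.IP := {P | closure P.carrier ⊆ U}

/-- The sets `𝒪_U` with `U = I⁺(p)` or `U = M \ J⁻(p)`, and the sets `𝒪'_U` with `U = I⁻(p)` or
`U = M \ J⁺(p)`. -/
def subbasis (S : Spacetime n M) : Set (Set S.IP) :=
  {O | ∃ p : M, O = S.meeting (S.chronFuture p) ∨ O = S.meeting (S.causalPast p)ᶜ ∨
    O = S.inside (S.chronPast p) ∨ O = S.inside (S.causalFuture p)ᶜ}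

/-- The topology `τ` on the set of indecomposable past sets. -/
instance (S : Spacetime n M) : TopologicalSpace S.IP := generateFrom S.subbasis

/-- The proper indecomposable past sets: those of the form `I⁻(p)`. -/
def PIPs (S : Spacetime n M) : Set S.IP := {P | ∃ p : M, P.carrier = S.chronPast p}

end Spacetime

/-! Two facts of causality theory carry the theorem: the sets `I⁺(p)`, `I⁻(p)` are open, and the
push-up property holds (`p ≪ q ≤ r` or `p ≤ q ≪ r` gives `p ≪ r`). Both are proved in charts,
without geodesics. Openness: short coordinate segments with direction near a future timelike vector
are timelike (`exists_chron_segment`). Push-up: a causal curve in a small chart becomes timelike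
when displaced along a timelike constant field at a rate dominating the displacement
(`exists_rate_forall_perturbation_neg`). This puts its endpoints in the relation `ClosureChron`,
which is transitive and absorbed by `≪`.

Hausdorff: if `P ⊄ Q`, some `p ≪ p'` in `P` has `p ∉ Q`. Meeting `I⁺(p')` and having closure
disjoint from `J⁺(p')` then separate `P` from `Q`.

Dense: each subbasic condition on `P` passes to `I⁻(p)` for all `p ∈ P` beyond some point of `P`.
Since `P` is directed for `≪`, one `p` serves finitely many conditions.

Open: for `r ∈ I⁺(p)`, the IPs with closure in `I⁻(r)` form a neighborhood of `I⁻(p)`. Such an IP is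
a PIP, by compactness of causal diamonds (`mem_PIPs_of_mem_inside_chronPast`). -/

set_option linter.unusedSectionVars false

/-! ### Linear algebra of Lorentzian forms -/

section LorentzianForm

variable {V : Type*} [AddCommGroup V] [Module ℝ V] {B : V →ₗ[ℝ] V →ₗ[ℝ] ℝ} {e : V}

/-- A symmetric form that is positive on the complement of a negative vector `e` satisfies the
Cauchy-Schwarz inequality on that complement. -/
lemma sq_le_mul_of_orthogonal (hB : ∀ v w, B v w = B w v)
    (hpos : ∀ w, B e w = 0 → w ≠ 0 → 0 < B w w) {v w : V} (hv : B e v = 0) (hw : B e w = 0) :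
    B v w ^ 2 ≤ B v v * B w w := by
  have h : ∀ t : ℝ, 0 ≤ B w w * (t * t) + 2 * B v w * t + B v v := fun t ↦ by
    have h1 : B (v + t • w) (v + t • w) = B w w * (t * t) + 2 * B v w * t + B v v := by
      simp only [map_add, map_smul, LinearMap.add_apply, LinearMap.smul_apply, smul_eq_mul, hB w v]
      ring
    rw [← h1]
    by_cases h0 : v + t • w = 0
    · simp [h0]
    · exact (hpos _ (by simp [hv, hw]) h0).le
  have := discrim_le_zero h
  rw [discrim] at this
  nlinarith

/-- Two timelike vectors have a nonzero product, whose sign is determined by the products with a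
negative vector. -/
lemma mul_mul_neg_of_timelike (hB : ∀ v w, B v w = B w v) (he : B e e < 0)
    (hpos : ∀ w, B e w = 0 → w ≠ 0 → 0 < B w w) {v w : V} (hv : B v v < 0) (hw : B w w < 0) :
    B v w * (B e v * B e w) < 0 := by
  set α := B e e
  have hα : α ≠ 0 := he.ne
  -- `a` and `b` are the components along `e`; Cauchy-Schwarz applies to the remainders.
  set a := B e v / α
  set b := B e w / α
  have ha : B e v = a * α := by simp only [a]; field_simp
  have hb : B e w = b * α := by simp only [b]; field_simp
  have hv' : B e (v - a • e) = 0 := by simp [ha, α]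
  have hw' : B e (w - b • e) = 0 := by simp [hb, α]
  have key := sq_le_mul_of_orthogonal hB hpos hv' hw'
  have h1 : B (v - a • e) (w - b • e) = B v w - a * b * α := by
    simp only [map_sub, map_smul, LinearMap.sub_apply, LinearMap.smul_apply, smul_eq_mul, hB v e,
      ha, hb]
    simp only [α]; ring
  have h2 : B (v - a • e) (v - a • e) = B v v - a ^ 2 * α := by
    simp only [map_sub, map_smul, LinearMap.sub_apply, LinearMap.smul_apply, smul_eq_mul, hB v e,
      ha]
    simp only [α]; ring
  have h3 : B (w - b • e) (w - b • e) = B w w - b ^ 2 * α := by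
    simp only [map_sub, map_smul, LinearMap.sub_apply, LinearMap.smul_apply, smul_eq_mul, hB w e,
      hb]
    simp only [α]; ring
  have p2 : 0 ≤ B v v - a ^ 2 * α := by
    rw [← h2]
    by_cases h0 : v - a • e = 0
    · simp [h0]
    · exact (hpos _ hv' h0).le
  have p3 : 0 ≤ B w w - b ^ 2 * α := by
    rw [← h3]
    by_cases h0 : w - b • e = 0
    · simp [h0]
    · exact (hpos _ hw' h0).le
  rw [h1, h2, h3] at key
  rw [ha, hb]
  have hq : (B v v - a ^ 2 * α) * (B w w - b ^ 2 * α) < (a * b * α) ^ 2 := by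
    have : 0 < a ^ 2 * (-α) := by linarith
    nlinarith [mul_nonneg p2 p3]
  -- `B v w` differs from `a * b * α` by less than `|a * b * α|`, so the two have the same sign.
  have hlt : (B v w - a * b * α) ^ 2 < (a * b * α) ^ 2 := key.trans_lt hq
  have h4 : B v w * (B v w - 2 * (a * b * α)) < 0 := by nlinarith
  have h5 : B v w * (a * b * α) > 0 := by nlinarith [sq_nonneg (B v w)]
  nlinarith

end LorentzianForm

/-! ### Time cones -/

namespace Spacetime

variable {n : ℕ} {M : Type*} [TopologicalSpace M]
  [ChartedSpace (EuclideanSpace ℝ (Fin n)) M] [IsManifold (𝓡 n) ∞ M]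

lemma val_mul_neg (S : Spacetime n M) (x : M) : ∃ e : TangentSpace (𝓡 n) x,
    ∀ v w, S.val x v v < 0 → S.val x w w < 0 →
      S.val x v w * (S.val x e v * S.val x e w) < 0 := by
  obtain ⟨e, he, hpos⟩ := S.signature x
  refine ⟨e, fun v w hv hw ↦ ?_⟩
  have := mul_mul_neg_of_timelike (B := (ContinuousLinearMap.coeLM ℝ) ∘ₗ
    (S.val x : TangentSpace (𝓡 n) x →ₗ[ℝ] TangentSpace (𝓡 n) x →L[ℝ] ℝ)) (e := e)
    (fun v w ↦ S.symm x v w) he hpos hv hw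
  exact this

lemma val_self_neg {S : Spacetime n M} {x : M} {v : TangentSpace (𝓡 n) x}
    (hv : v ∈ S.futureCone x) : S.val x v v < 0 := by
  obtain ⟨u, -, h⟩ := S.isTimeCone x
  exact (h ▸ hv).1

/-- The signs of `g(e, ·)` determine the sign of the product of two timelike vectors, so any member
of the cone can replace the vector `u` that defines it. -/
lemma mem_futureCone_iff {S : Spacetime n M} {x : M} {X v : TangentSpace (𝓡 n) x}
    (hX : X ∈ S.futureCone x) : v ∈ S.futureCone x ↔ S.val x v v < 0 ∧ S.val x X v < 0 := by
  obtain ⟨u, hu, h⟩ := S.isTimeCone x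
  obtain ⟨e, he⟩ := S.val_mul_neg x
  rw [h] at hX ⊢
  refine and_congr_right fun hv ↦ ?_
  have h1 := he u X hu hX.1
  have h2 := he u v hu hv
  have h3 := he X v hX.1 hv
  have h4 := hX.2
  generalize S.val x u X = p at *
  generalize S.val x u v = q at *
  generalize S.val x X v = r at *
  generalize S.val x e u = s at *
  generalize S.val x e X = t at *
  generalize S.val x e v = z at *
  have h5 : 0 < s * t := by nlinarith
  constructor
  · intro hq
    have h6 : 0 < s * z := by nlinarith
    have h7 : 0 < t * z := by
      by_contra hc
      nlinarith [mul_pos h5 h6, mul_nonneg (sq_nonneg s) (neg_nonneg.2 (not_lt.1 hc))]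
    nlinarith
  · intro hr
    have h6 : 0 < t * z := by nlinarith
    have h7 : 0 < s * z := by
      by_contra hc
      nlinarith [mul_pos h5 h6, mul_nonneg (sq_nonneg t) (neg_nonneg.2 (not_lt.1 hc))]
    nlinarith

lemma futureCone_nonempty (S : Spacetime n M) (x : M) : (S.futureCone x).Nonempty := by
  obtain ⟨u, hu, h⟩ := S.isTimeCone x
  exact ⟨u, by rw [h]; exact ⟨hu, hu⟩⟩

lemma IsFutureTimelike.isFutureCausal {S : Spacetime n M} {x : M} {v : TangentSpace (𝓡 n) x}
    (hv : S.IsFutureTimelike x v) : S.IsFutureCausal x v := by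
  have h := val_self_neg hv
  refine ⟨?_, h.le, fun u hu ↦ ((mem_futureCone_iff hu).1 hv).2⟩
  rintro rfl
  simp at h

end Spacetime

/-! ### Operations on piecewise `C¹` curves -/

namespace Spacetime

variable {n : ℕ} {M : Type*} [TopologicalSpace M]
  [ChartedSpace (EuclideanSpace ℝ (Fin n)) M] [IsManifold (𝓡 n) ∞ M] {S : Spacetime n M}
  {γ γ' : ℝ → M} {a b c d t : ℝ}

lemma uniqueMDiffWithinAt_Icc (hab : a < b) (ht : t ∈ Icc a b) :
    UniqueMDiffWithinAt 𝓘(ℝ, ℝ) (Icc a b) t :=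
  (uniqueDiffOn_Icc hab t ht).uniqueMDiffWithinAt

/-- The equality is stated in the total space because the two velocities live in tangent spaces at
points that are only provably equal. -/
lemma tangent_velocity_congr (h : EqOn γ γ' (Icc a b)) (ht : t ∈ Icc a b) :
    (⟨γ t, velocity n γ a b t⟩ : TangentBundle (𝓡 n) M) = ⟨γ' t, velocity n γ' a b t⟩ := by
  have h1 : γ t = γ' t := h ht
  have h2 : mfderivWithin 𝓘(ℝ, ℝ) (𝓡 n) γ (Icc a b) t =
      mfderivWithin 𝓘(ℝ, ℝ) (𝓡 n) γ' (Icc a b) t := mfderivWithin_congr h h1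
  have h3 : (velocity n γ a b t : EuclideanSpace ℝ (Fin n)) = velocity n γ' a b t :=
    congrArg (fun L : ℝ →L[ℝ] EuclideanSpace ℝ (Fin n) ↦ L 1) h2
  refine Bundle.TotalSpace.ext h1 ?_
  exact heq_of_eq h3

lemma isFutureTimelike_velocity_congr (h : EqOn γ γ' (Icc a b)) (ht : t ∈ Icc a b) :
    S.IsFutureTimelike (γ t) (velocity n γ a b t) ↔
      S.IsFutureTimelike (γ' t) (velocity n γ' a b t) :=
  iff_of_eq <| congrArg (fun p : TangentBundle (𝓡 n) M ↦ S.IsFutureTimelike p.1 p.2)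
    (tangent_velocity_congr h ht)

lemma isFutureCausal_velocity_congr (h : EqOn γ γ' (Icc a b)) (ht : t ∈ Icc a b) :
    S.IsFutureCausal (γ t) (velocity n γ a b t) ↔
      S.IsFutureCausal (γ' t) (velocity n γ' a b t) :=
  iff_of_eq <| congrArg (fun p : TangentBundle (𝓡 n) M ↦ S.IsFutureCausal p.1 p.2)
    (tangent_velocity_congr h ht)

lemma velocity_eq_of_subset (hcd : c < d) (hsub : Icc c d ⊆ Icc a b)
    (hγ : ContMDiffOn 𝓘(ℝ, ℝ) (𝓡 n) 1 γ (Icc a b)) (ht : t ∈ Icc c d) :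
    velocity n γ c d t = velocity n γ a b t := by
  unfold velocity
  rw [mfderivWithin_subset hsub (uniqueMDiffWithinAt_Icc hcd ht)
    ((hγ t (hsub ht)).mdifferentiableWithinAt one_ne_zero)]

lemma IsTimelikeCurve.lt (h : S.IsTimelikeCurve γ a b) : a < b := by
  induction h with
  | piece hab => exact hab
  | concat _ _ h₁ h₂ => exact h₁.trans h₂

lemma IsTimelikeCurve.congr (h : S.IsTimelikeCurve γ a b) (hγ : EqOn γ γ' (Icc a b)) :
    S.IsTimelikeCurve γ' a b := by
  induction h with
  | piece hab hs hv =>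
    exact .piece hab (hs.congr fun t ht ↦ (hγ ht).symm)
      fun t ht ↦ (isFutureTimelike_velocity_congr hγ ht).1 (hv t ht)
  | concat h₁ h₂ ih₁ ih₂ =>
    exact .concat (ih₁ (hγ.mono (Icc_subset_Icc_right h₂.lt.le)))
      (ih₂ (hγ.mono (Icc_subset_Icc_left h₁.lt.le)))

lemma IsTimelikeCurve.isCausalCurve (h : S.IsTimelikeCurve γ a b) : S.IsCausalCurve γ a b := by
  induction h with
  | piece hab hs hv => exact .piece hab hs fun t ht ↦ (hv t ht).isFutureCausal
  | concat _ _ ih₁ ih₂ => exact .concat ih₁ ih₂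

lemma IsTimelikeCurve.comp_add (h : S.IsTimelikeCurve γ a b) (s : ℝ) :
    S.IsTimelikeCurve (fun t ↦ γ (t + s)) (a - s) (b - s) := by
  induction h with
  | @piece a b hab hs hv =>
    have hmaps : MapsTo (fun t : ℝ ↦ t + s) (Icc (a - s) (b - s)) (Icc a b) := fun t ht ↦
      ⟨by linarith [ht.1], by linarith [ht.2]⟩
    have hadd : ContMDiff 𝓘(ℝ, ℝ) 𝓘(ℝ, ℝ) 1 (fun t : ℝ ↦ t + s) :=
      (contDiff_id.add contDiff_const).contMDiff
    have hab' : a - s < b - s := by linarith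
    refine .piece hab' (hs.comp hadd.contMDiffOn hmaps) fun t ht ↦ ?_
    have h1 : velocity n (fun t ↦ γ (t + s)) (a - s) (b - s) t = velocity n γ a b (t + s) := by
      have hu := uniqueMDiffWithinAt_Icc hab' ht
      have h2 := mfderivWithin_comp (u := Icc a b) t
        ((hs (t + s) (hmaps ht)).mdifferentiableWithinAt one_ne_zero)
        (hadd.contMDiffOn.mdifferentiableOn one_ne_zero t ht) hmaps hu
      have h3 : mfderivWithin 𝓘(ℝ, ℝ) 𝓘(ℝ, ℝ) (fun t : ℝ ↦ t + s) (Icc (a - s) (b - s)) t =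
          ContinuousLinearMap.id ℝ ℝ := by
        rw [mfderivWithin_eq_fderivWithin]
        exact ((hasFDerivAt_id t).add_const s).hasFDerivWithinAt.fderivWithin
          (uniqueDiffOn_Icc hab' t ht)
      unfold velocity
      rw [h3] at h2
      exact congrArg (fun L : ℝ →L[ℝ] EuclideanSpace ℝ (Fin n) ↦ L 1) h2
    have h4 := hv (t + s) (hmaps ht)
    rw [← h1] at h4
    exact h4
  | concat _ _ ih₁ ih₂ => exact .concat ih₁ ih₂

lemma Chron.trans {p q r : M} (h₁ : S.Chron p q) (h₂ : S.Chron q r) : S.Chron p r := by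
  obtain ⟨γ, a, b, h, rfl, rfl⟩ := h₁
  obtain ⟨σ, c, d, h', hc, rfl⟩ := h₂
  -- This shift makes the second curve start at parameter `b`, where the first one ends.
  have hs := h'.comp_add (c - b)
  rw [sub_sub_cancel] at hs
  refine ⟨fun t ↦ if t ≤ b then γ t else σ (t + (c - b)), a, d - (c - b),
    .concat (h.congr fun t ht ↦ ?_) (hs.congr fun t ht ↦ ?_), ?_, ?_⟩
  · simp [ht.2]
  · rcases ht.1.eq_or_lt with rfl | hlt
    · simp [hc]
    · simp [hlt.not_ge]
  · simp [h.lt.le]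
  · simp [hs.lt.not_ge]

lemma Chron.causal {p q : M} (h : S.Chron p q) : S.Causal p q := by
  obtain ⟨γ, a, b, h, ha, hb⟩ := h
  exact Or.inr ⟨γ, a, b, h.isCausalCurve, ha, hb⟩

lemma chron_of_subset (hγ : ContMDiffOn 𝓘(ℝ, ℝ) (𝓡 n) 1 γ (Icc a b))
    (hv : ∀ t ∈ Icc a b, S.IsFutureTimelike (γ t) (velocity n γ a b t)) (hcd : c < d)
    (hsub : Icc c d ⊆ Icc a b) : S.Chron (γ c) (γ d) :=
  ⟨γ, c, d, .piece hcd (hγ.mono hsub) fun t ht ↦ by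
    rw [velocity_eq_of_subset hcd hsub hγ ht]; exact hv t (hsub ht), rfl, rfl⟩

end Spacetime

/-! ### The metric in chart coordinates -/

namespace Spacetime

variable {n : ℕ} {M : Type*} [TopologicalSpace M]
  [ChartedSpace (EuclideanSpace ℝ (Fin n)) M] [IsManifold (𝓡 n) ∞ M]

/-- The differential of the inverse of the chart at `x₀`. -/
noncomputable def chartSymmDeriv (x₀ : M) (y : EuclideanSpace ℝ (Fin n)) :
    EuclideanSpace ℝ (Fin n) →L[ℝ] TangentSpace (𝓡 n) ((extChartAt (𝓡 n) x₀).symm y) :=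
  mfderivWithin 𝓘(ℝ, EuclideanSpace ℝ (Fin n)) (𝓡 n) (extChartAt (𝓡 n) x₀).symm
    (range (𝓡 n)) y

/-- The metric in the coordinates of the chart at `x₀`. -/
noncomputable def coordMetric (S : Spacetime n M) (x₀ : M) (y : EuclideanSpace ℝ (Fin n)) :
    EuclideanSpace ℝ (Fin n) →L[ℝ] EuclideanSpace ℝ (Fin n) →L[ℝ] ℝ :=
  ContinuousLinearMap.bilinearComp (E := EuclideanSpace ℝ (Fin n)) (F := EuclideanSpace ℝ (Fin n))
    (S.val ((extChartAt (𝓡 n) x₀).symm y)) (chartSymmDeriv x₀ y) (chartSymmDeriv x₀ y)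

lemma coordMetric_apply (S : Spacetime n M) (x₀ : M) (y v w : EuclideanSpace ℝ (Fin n)) :
    S.coordMetric x₀ y v w = S.val ((extChartAt (𝓡 n) x₀).symm y)
      (chartSymmDeriv x₀ y v) (chartSymmDeriv x₀ y w) := rfl

/-- The vector field on the domain of the chart at `x₀` with constant coordinates `v`. -/
noncomputable def coordField (x₀ : M) (v : EuclideanSpace ℝ (Fin n)) (x : M) :
    TangentSpace (𝓡 n) x :=
  (trivializationAt (EuclideanSpace ℝ (Fin n)) (TangentSpace (𝓡 n)) x₀).symmL ℝ x v

lemma contMDiffOn_coordField (x₀ : M) (v : EuclideanSpace ℝ (Fin n)) :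
    ContMDiffOn (𝓡 n) (𝓡 n).tangent ∞
      (fun x ↦ (⟨x, coordField x₀ v x⟩ : TangentBundle (𝓡 n) M))
      (extChartAt (𝓡 n) x₀).source := by
  set e := trivializationAt (EuclideanSpace ℝ (Fin n)) (TangentSpace (𝓡 n) (M := M)) x₀
  have hsrc : (extChartAt (𝓡 n) x₀).source = e.baseSet := by
    rw [extChartAt_source]; rfl
  have h := e.contMDiffOn_symm (IB := 𝓡 n) (n := ∞)
  have h2 : ContMDiffOn (𝓡 n) ((𝓡 n).prod 𝓘(ℝ, EuclideanSpace ℝ (Fin n))) ∞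
      (fun x : M ↦ ((x, v) : M × EuclideanSpace ℝ (Fin n))) (extChartAt (𝓡 n) x₀).source :=
    (contMDiff_id.prodMk contMDiff_const).contMDiffOn
  have hmaps : MapsTo (fun x : M ↦ (x, v)) (extChartAt (𝓡 n) x₀).source e.target := fun x hx ↦ by
    rw [e.mem_target]; exact hsrc ▸ hx
  refine (h.comp h2 hmaps).congr fun x hx ↦ ?_
  refine Eq.trans ?_ (e.mk_symm (hsrc ▸ hx) v)
  exact congrArg (Bundle.TotalSpace.mk x) (e.symmL_apply (R := ℝ) (hsrc ▸ hx) v)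

/-- Links the coordinate picture to the tangent bundle trivialization, so that smoothness of bundle
sections yields regularity of `coordMetric`. -/
lemma chartSymmDeriv_eq_coordField (x₀ : M) {y : EuclideanSpace ℝ (Fin n)}
    (hy : y ∈ (extChartAt (𝓡 n) x₀).target) (v : EuclideanSpace ℝ (Fin n)) :
    chartSymmDeriv x₀ y v = coordField x₀ v ((extChartAt (𝓡 n) x₀).symm y) := by
  have : IsManifold (𝓡 n) 1 M := .of_le (n := ∞) (by simp)
  have hx : (extChartAt (𝓡 n) x₀).symm y ∈
      (chartAt (EuclideanSpace ℝ (Fin n)) x₀).source := by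
    rw [← extChartAt_source (𝓡 n)]
    exact (extChartAt (𝓡 n) x₀).map_target hy
  have h := TangentBundle.symmL_trivializationAt (I := 𝓡 n) hx
  rw [(extChartAt (𝓡 n) x₀).right_inv hy] at h
  exact (congrArg (fun L : EuclideanSpace ℝ (Fin n) →L[ℝ] EuclideanSpace ℝ (Fin n) ↦ L v) h).symm

lemma contDiffOn_coordMetric (S : Spacetime n M) (x₀ : M) :
    ContDiffOn ℝ 1 (S.coordMetric x₀) (extChartAt (𝓡 n) x₀).target := by
  refine contDiffOn_clm_apply.2 fun v ↦ contDiffOn_clm_apply.2 fun w ↦ ?_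
  have h := ContMDiffOn.clm_bundle_apply₂ (F₁ := EuclideanSpace ℝ (Fin n))
    (F₂ := EuclideanSpace ℝ (Fin n)) (F₃ := ℝ) (E₃ := fun _ : M ↦ ℝ) S.contMDiff.contMDiffOn
    (contMDiffOn_coordField x₀ v) (contMDiffOn_coordField x₀ w)
  have h' : ContMDiffOn (𝓡 n) 𝓘(ℝ, ℝ) ∞
      (fun x : M ↦ S.val x (coordField x₀ v x) (coordField x₀ w x))
      (extChartAt (𝓡 n) x₀).source := fun x hx ↦ (Bundle.contMDiffWithinAt_totalSpace.1 (h x hx)).2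
  have h2 := (h'.comp (contMDiffOn_extChartAt_symm x₀)
    (fun y hy ↦ (extChartAt (𝓡 n) x₀).map_target hy)).contDiffOn.of_le (m := 1) (by simp)
  refine h2.congr fun y hy ↦ ?_
  rw [coordMetric_apply, chartSymmDeriv_eq_coordField x₀ hy, chartSymmDeriv_eq_coordField x₀ hy]
  rfl

end Spacetime

/-! ### Adapted coordinate balls -/

namespace Spacetime

variable {n : ℕ} {M : Type*} [TopologicalSpace M]
  [ChartedSpace (EuclideanSpace ℝ (Fin n)) M] [IsManifold (𝓡 n) ∞ M]

lemma coordField_self (x₀ : M) (v : EuclideanSpace ℝ (Fin n)) : coordField x₀ v x₀ = v := by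
  have : IsManifold (𝓡 n) 1 M := .of_le (n := ∞) (by simp)
  have h : (trivializationAt (EuclideanSpace ℝ (Fin n)) (TangentSpace (𝓡 n)) x₀).symmL ℝ x₀ =
      ContinuousLinearMap.id ℝ _ :=
    (TangentBundle.symmL_trivializationAt (I := 𝓡 n) (mem_chart_source _ x₀)).trans
      mfderivWithin_range_extChartAt_symm
  exact congrArg (fun L : EuclideanSpace ℝ (Fin n) →L[ℝ] EuclideanSpace ℝ (Fin n) ↦ L v) h

/-- Near every point some constant vector field of the chart is future timelike. -/
lemma exists_coordField_mem_futureCone (S : Spacetime n M) (x₀ : M) :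
    ∃ T : EuclideanSpace ℝ (Fin n), ∀ᶠ x in 𝓝 x₀, coordField x₀ T x ∈ S.futureCone x := by
  obtain ⟨U, hU, X, hXc, hX⟩ := S.continuousChoice x₀
  set T : EuclideanSpace ℝ (Fin n) := X x₀
  have hx₀ : x₀ ∈ U := mem_of_mem_nhds hU
  have hs : (extChartAt (𝓡 n) x₀).source ∈ 𝓝 x₀ := extChartAt_source_mem_nhds x₀
  -- Continuity is phrased as `C⁰` so that the pairing lemma for smooth bundle sections applies. The
  -- two products are negative at `x₀`, hence nearby.
  have hT : ContMDiffOn (𝓡 n) (𝓡 n).tangent 0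
      (fun x ↦ (⟨x, coordField x₀ T x⟩ : TangentBundle (𝓡 n) M))
      (U ∩ (extChartAt (𝓡 n) x₀).source) :=
    ((contMDiffOn_coordField x₀ T).of_le (by simp)).mono inter_subset_right
  have hX0 : ContMDiffOn (𝓡 n) (𝓡 n).tangent 0
      (fun x ↦ (⟨x, X x⟩ : TangentBundle (𝓡 n) M)) (U ∩ (extChartAt (𝓡 n) x₀).source) :=
    (contMDiffOn_zero_iff.2 hXc).mono inter_subset_left
  have hg := (S.contMDiff.of_le (n := ∞) (m := 0) (by simp)).contMDiffOn
    (s := U ∩ (extChartAt (𝓡 n) x₀).source)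
  have hmem : U ∩ (extChartAt (𝓡 n) x₀).source ∈ 𝓝 x₀ := Filter.inter_mem hU hs
  have hxm := mem_of_mem_nhds hmem
  have h1 := ContMDiffOn.clm_bundle_apply₂ (F₁ := EuclideanSpace ℝ (Fin n))
    (F₂ := EuclideanSpace ℝ (Fin n)) (F₃ := ℝ) (E₃ := fun _ : M ↦ ℝ) hg hT hT
  have h2 := ContMDiffOn.clm_bundle_apply₂ (F₁ := EuclideanSpace ℝ (Fin n))
    (F₂ := EuclideanSpace ℝ (Fin n)) (F₃ := ℝ) (E₃ := fun _ : M ↦ ℝ) hg hX0 hT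
  have h1c : ContinuousAt (fun x ↦ S.val x (coordField x₀ T x) (coordField x₀ T x)) x₀ :=
    (Bundle.contMDiffWithinAt_totalSpace.1 (h1 x₀ hxm)).2.continuousWithinAt.continuousAt hmem
  have h2c : ContinuousAt (fun x ↦ S.val x (X x) (coordField x₀ T x)) x₀ :=
    (Bundle.contMDiffWithinAt_totalSpace.1 (h2 x₀ hxm)).2.continuousWithinAt.continuousAt hmem
  have hself : coordField x₀ T x₀ = X x₀ := coordField_self x₀ T
  have hneg := val_self_neg (hX x₀ hx₀)
  refine ⟨T, ?_⟩
  filter_upwards [hU, h1c.eventually_lt_const (u := 0) (by simpa only [hself] using hneg),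
    h2c.eventually_lt_const (u := 0) (by simpa only [hself] using hneg)] with x hxU hx1 hx2
  exact (mem_futureCone_iff (hX x hxU)).2 ⟨hx1, hx2⟩

/-- A coordinate ball on which the metric is Lipschitz and the constant vector field `T` is future
timelike. -/
structure IsAdaptedBall (S : Spacetime n M) (x₀ : M) (r : ℝ) (K : NNReal)
    (T : EuclideanSpace ℝ (Fin n)) : Prop where
  pos : 0 < r
  subset : Metric.ball (extChartAt (𝓡 n) x₀ x₀) r ⊆ (extChartAt (𝓡 n) x₀).target
  lipschitz : LipschitzOnWith K (S.coordMetric x₀) (Metric.ball (extChartAt (𝓡 n) x₀ x₀) r)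
  mem_futureCone : ∀ y ∈ Metric.ball (extChartAt (𝓡 n) x₀ x₀) r,
    chartSymmDeriv x₀ y T ∈ S.futureCone ((extChartAt (𝓡 n) x₀).symm y)

lemma exists_isAdaptedBall (S : Spacetime n M) (x₀ : M) : ∃ r K T, S.IsAdaptedBall x₀ r K T := by
  obtain ⟨T, hT⟩ := S.exists_coordField_mem_futureCone x₀
  have ht : (extChartAt (𝓡 n) x₀).target ∈ 𝓝 (extChartAt (𝓡 n) x₀ x₀) :=
    extChartAt_target_mem_nhds x₀
  obtain ⟨K, t, htn, hlip⟩ := ((S.contDiffOn_coordMetric x₀).contDiffAt ht).exists_lipschitzOnWith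
  have hc : Filter.Tendsto (extChartAt (𝓡 n) x₀).symm (𝓝 (extChartAt (𝓡 n) x₀ x₀)) (𝓝 x₀) := by
    simpa [ContinuousAt] using continuousAt_extChartAt_symm (I := 𝓡 n) x₀
  obtain ⟨r, hr, hball⟩ := Metric.mem_nhds_iff.1
    (Filter.inter_mem ht (Filter.inter_mem htn (hc.eventually hT)))
  refine ⟨r, K, T, hr, fun y hy ↦ (hball hy).1, hlip.mono fun y hy ↦ (hball hy).2.1,
    fun y hy ↦ ?_⟩
  rw [chartSymmDeriv_eq_coordField x₀ (hball hy).1]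
  exact (hball hy).2.2

namespace IsAdaptedBall

variable {S : Spacetime n M} {x₀ : M} {r : ℝ} {K : NNReal} {T : EuclideanSpace ℝ (Fin n)}
  (h : S.IsAdaptedBall x₀ r K T) {y v : EuclideanSpace ℝ (Fin n)}
include h

lemma isFutureTimelike_iff (hy : y ∈ Metric.ball (extChartAt (𝓡 n) x₀ x₀) r) :
    S.IsFutureTimelike ((extChartAt (𝓡 n) x₀).symm y) (chartSymmDeriv x₀ y v) ↔
      S.coordMetric x₀ y v v < 0 ∧ S.coordMetric x₀ y T v < 0 :=
  mem_futureCone_iff (h.mem_futureCone y hy)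

lemma coordMetric_self_neg (hy : y ∈ Metric.ball (extChartAt (𝓡 n) x₀ x₀) r) :
    S.coordMetric x₀ y T T < 0 := val_self_neg (h.mem_futureCone y hy)

lemma of_isFutureCausal (hy : y ∈ Metric.ball (extChartAt (𝓡 n) x₀ x₀) r)
    (hv : S.IsFutureCausal ((extChartAt (𝓡 n) x₀).symm y) (chartSymmDeriv x₀ y v)) :
    S.coordMetric x₀ y v v ≤ 0 ∧ S.coordMetric x₀ y T v < 0 :=
  ⟨hv.2.1, hv.2.2 _ (h.mem_futureCone y hy)⟩

end IsAdaptedBall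

lemma coordMetric_symm (S : Spacetime n M) (x₀ : M) (y v w : EuclideanSpace ℝ (Fin n)) :
    S.coordMetric x₀ y v w = S.coordMetric x₀ y w v := S.symm _ _ _

section Curves

variable {S : Spacetime n M} {x₀ : M} {a b t : ℝ} {c : ℝ → EuclideanSpace ℝ (Fin n)} {γ : ℝ → M}

lemma contMDiffOn_extChartAt_symm_comp (hc : ContDiffOn ℝ 1 c (Icc a b))
    (hmaps : MapsTo c (Icc a b) (extChartAt (𝓡 n) x₀).target) :
    ContMDiffOn 𝓘(ℝ, ℝ) (𝓡 n) 1 (fun t ↦ (extChartAt (𝓡 n) x₀).symm (c t)) (Icc a b) := by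
  have : IsManifold (𝓡 n) 1 M := .of_le (n := ∞) (by simp)
  exact (contMDiffOn_extChartAt_symm x₀).comp hc.contMDiffOn hmaps

lemma velocity_extChartAt_symm_comp (hab : a < b) (ht : t ∈ Icc a b)
    (hc : ContDiffOn ℝ 1 c (Icc a b))
    (hmaps : MapsTo c (Icc a b) (extChartAt (𝓡 n) x₀).target) :
    velocity n (fun t ↦ (extChartAt (𝓡 n) x₀).symm (c t)) a b t =
      chartSymmDeriv x₀ (c t) (derivWithin c (Icc a b) t) := by
  have : IsManifold (𝓡 n) 1 M := .of_le (n := ∞) (by simp)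
  have hd : MDifferentiableWithinAt 𝓘(ℝ, EuclideanSpace ℝ (Fin n)) (𝓡 n)
      (extChartAt (𝓡 n) x₀).symm (range (𝓡 n)) (c t) :=
    mdifferentiableWithinAt_extChartAt_symm (hmaps ht)
  have h := mfderivWithin_comp (u := range (𝓡 n)) t hd
    ((hc t ht).differentiableWithinAt one_ne_zero).mdifferentiableWithinAt
    (fun s hs ↦ by simp) (uniqueMDiffWithinAt_Icc hab ht)
  rw [mfderivWithin_eq_fderivWithin] at h
  exact congrArg (fun L : ℝ →L[ℝ] EuclideanSpace ℝ (Fin n) ↦ L 1) h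

lemma contDiffOn_extChartAt_comp (hγ : ContMDiffOn 𝓘(ℝ, ℝ) (𝓡 n) 1 γ (Icc a b))
    (hmaps : MapsTo γ (Icc a b) (extChartAt (𝓡 n) x₀).source) :
    ContDiffOn ℝ 1 (fun t ↦ extChartAt (𝓡 n) x₀ (γ t)) (Icc a b) := by
  have : IsManifold (𝓡 n) 1 M := .of_le (n := ∞) (by simp)
  exact (contMDiffOn_extChartAt.comp hγ
    (fun t ht ↦ by simpa [extChartAt_source] using hmaps ht)).contDiffOn

end Curves

end Spacetime

/-! ### Timelike segments and openness of chronological futures and pasts -/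

namespace Spacetime

variable {n : ℕ} {M : Type*} [TopologicalSpace M]
  [ChartedSpace (EuclideanSpace ℝ (Fin n)) M] [IsManifold (𝓡 n) ∞ M]

section Segments

lemma exists_ball_forall_neg {E : Type*} [NormedAddCommGroup E] [NormedSpace ℝ E]
    {G : E → E →L[ℝ] E →L[ℝ] ℝ} {T y₀ v₀ : E} (hG : ContinuousAt G y₀)
    (h1 : G y₀ v₀ v₀ < 0) (h2 : G y₀ T v₀ < 0) :
    ∃ ρ > 0, ∀ y ∈ Metric.ball y₀ ρ, ∀ v ∈ Metric.ball v₀ ρ, G y v v < 0 ∧ G y T v < 0 := by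
  have hG' : ContinuousAt (fun p : E × E ↦ G p.1) (y₀, v₀) :=
    ContinuousAt.comp (f := Prod.fst) hG continuousAt_fst
  have h1' : ∀ᶠ p : E × E in 𝓝 (y₀, v₀), G p.1 p.2 p.2 < 0 :=
    ((hG'.clm_apply continuousAt_snd).clm_apply continuousAt_snd).eventually_lt_const h1
  have h2' : ∀ᶠ p : E × E in 𝓝 (y₀, v₀), G p.1 T p.2 < 0 :=
    ((hG'.clm_apply continuousAt_const).clm_apply continuousAt_snd).eventually_lt_const h2
  obtain ⟨ρ, hρ, hball⟩ := Metric.eventually_nhds_iff_ball.1 (h1'.and h2')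
  exact ⟨ρ, hρ, fun y hy v hv ↦ hball (y, v) (by rw [← ball_prod_same]; exact ⟨hy, hv⟩)⟩

variable {S : Spacetime n M} {x₀ : M} {r : ℝ} {K : NNReal} {T : EuclideanSpace ℝ (Fin n)}
  {a b : ℝ} {c c' : ℝ → EuclideanSpace ℝ (Fin n)}

/-- A coordinate curve with future timelike velocity joins chronologically related points. -/
lemma IsAdaptedBall.chron_of_curve (h : S.IsAdaptedBall x₀ r K T) (hab : a < b)
    (hc : ContDiffOn ℝ 1 c (Icc a b))
    (hc' : ∀ t ∈ Icc a b, HasDerivWithinAt c (c' t) (Icc a b) t)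
    (hmaps : MapsTo c (Icc a b) (Metric.ball (extChartAt (𝓡 n) x₀ x₀) r))
    (h1 : ∀ t ∈ Icc a b, S.coordMetric x₀ (c t) (c' t) (c' t) < 0)
    (h2 : ∀ t ∈ Icc a b, S.coordMetric x₀ (c t) T (c' t) < 0) :
    S.Chron ((extChartAt (𝓡 n) x₀).symm (c a)) ((extChartAt (𝓡 n) x₀).symm (c b)) := by
  have hm := hmaps.mono_right h.subset
  refine ⟨_, a, b, .piece hab (contMDiffOn_extChartAt_symm_comp hc hm) fun t ht ↦ ?_, rfl, rfl⟩
  rw [velocity_extChartAt_symm_comp hab ht hc hm,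
    (hc' t ht).derivWithin (uniqueDiffOn_Icc hab t ht)]
  exact (h.isFutureTimelike_iff (hmaps ht)).2 ⟨h1 t ht, h2 t ht⟩

lemma isFutureTimelike_chartSymmDeriv_self {v : EuclideanSpace ℝ (Fin n)} :
    S.IsFutureTimelike ((extChartAt (𝓡 n) x₀).symm (extChartAt (𝓡 n) x₀ x₀))
      (chartSymmDeriv x₀ (extChartAt (𝓡 n) x₀ x₀) v) ↔ S.IsFutureTimelike x₀ v := by
  -- The base point is generalized because `φ.symm (φ x₀)` equals `x₀` only propositionally.
  have h : ∀ x : M, x = x₀ → (S.IsFutureTimelike x (coordField x₀ v x) ↔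
      S.IsFutureTimelike x₀ v) := by
    rintro x rfl
    rw [coordField_self]
  rw [chartSymmDeriv_eq_coordField x₀ (mem_extChartAt_target x₀)]
  exact h _ (extChartAt_to_inv x₀)

lemma IsAdaptedBall.continuousAt_coordMetric (h : S.IsAdaptedBall x₀ r K T)
    {y : EuclideanSpace ℝ (Fin n)} (hy : y ∈ Metric.ball (extChartAt (𝓡 n) x₀ x₀) r) :
    ContinuousAt (S.coordMetric x₀) y :=
  h.lipschitz.continuousOn.continuousAt (Metric.isOpen_ball.mem_nhds hy)

/-- Short coordinate segments in a direction close to a future timelike vector are timelike. -/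
lemma exists_chron_segment (x₀ : M) {v₀ : EuclideanSpace ℝ (Fin n)}
    (hv₀ : S.IsFutureTimelike x₀ v₀) : ∃ ρ > 0, ∀ (y v : EuclideanSpace ℝ (Fin n)) (s : ℝ),
      0 < s → y ∈ Metric.ball (extChartAt (𝓡 n) x₀ x₀) ρ →
      y + s • v ∈ Metric.ball (extChartAt (𝓡 n) x₀ x₀) ρ → v ∈ Metric.ball v₀ ρ →
      S.Chron ((extChartAt (𝓡 n) x₀).symm y) ((extChartAt (𝓡 n) x₀).symm (y + s • v)) := by
  obtain ⟨r, K, T, h⟩ := S.exists_isAdaptedBall x₀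
  set y₀ := extChartAt (𝓡 n) x₀ x₀
  have hy₀ : y₀ ∈ Metric.ball y₀ r := Metric.mem_ball_self h.pos
  have hneg := (h.isFutureTimelike_iff hy₀).1 (isFutureTimelike_chartSymmDeriv_self.2 hv₀)
  obtain ⟨ρ, hρ, hball⟩ := exists_ball_forall_neg (h.continuousAt_coordMetric hy₀) hneg.1 hneg.2
  refine ⟨min ρ r, lt_min hρ h.pos, fun y v s hs hy hys hv ↦ ?_⟩
  have hseg : ∀ t ∈ Icc 0 s, y + t • v ∈ Metric.ball y₀ (min ρ r) := fun t ht ↦ by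
    have := (convex_ball y₀ (min ρ r)).add_smul_sub_mem hy hys
      (t := t / s) ⟨div_nonneg ht.1 hs.le, (div_le_one hs).2 ht.2⟩
    rwa [add_sub_cancel_left, smul_smul, div_mul_cancel₀ _ hs.ne'] at this
  have hmem : ∀ t ∈ Icc 0 s, _ := fun t ht ↦ hball (y + t • v)
    (Metric.ball_subset_ball (min_le_left _ _) (hseg t ht)) v
    (Metric.ball_subset_ball (min_le_left _ _) hv)
  have key := h.chron_of_curve (c := fun t ↦ y + t • v) (c' := fun _ ↦ v) hs
    (by fun_prop)
    (fun t _ ↦ by simpa using (((hasDerivAt_id t).smul_const v).const_add y).hasDerivWithinAt)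
    (fun t ht ↦ Metric.ball_subset_ball (min_le_right _ _) (hseg t ht))
    (fun t ht ↦ (hmem t ht).1) (fun t ht ↦ (hmem t ht).2)
  simpa using key

end Segments

section Openness

variable {S : Spacetime n M} {γ : ℝ → M} {a b t₀ : ℝ}

/-- For `t` near `t₀` the difference quotient of the curve in the chart is close to its velocity,
and stays so when `γ t₀` is replaced by a nearby `z`. The coordinate segment between `γ t` and `z`
is then timelike. -/
lemma eventually_chron_of_velocity (ht₀ : t₀ ∈ Icc a b)
    (hγ : ContMDiffOn 𝓘(ℝ, ℝ) (𝓡 n) 1 γ (Icc a b))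
    (hv : S.IsFutureTimelike (γ t₀) (velocity n γ a b t₀)) :
    ∀ᶠ t in 𝓝[Icc a b \ {t₀}] t₀, (t < t₀ → ∀ᶠ z in 𝓝 (γ t₀), S.Chron (γ t) z) ∧
      (t₀ < t → ∀ᶠ z in 𝓝 (γ t₀), S.Chron z (γ t)) := by
  have : IsManifold (𝓡 n) 1 M := .of_le (n := ∞) (by simp)
  set φ := extChartAt (𝓡 n) (γ t₀) with hφ
  set v₀ : EuclideanSpace ℝ (Fin n) := velocity n γ a b t₀ with hv₀
  obtain ⟨ρ, hρ, hseg⟩ := exists_chron_segment (S := S) (γ t₀) hv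
  rw [← hφ] at hseg
  have hsrc : φ.source ∈ 𝓝 (γ t₀) := extChartAt_source_mem_nhds (γ t₀)
  have hφc : ContinuousAt φ (γ t₀) := continuousAt_extChartAt (γ t₀)
  have hγc : ContinuousWithinAt γ (Icc a b) t₀ := (hγ t₀ ht₀).continuousWithinAt
  have hd : HasDerivWithinAt (fun t ↦ φ (γ t)) v₀ (Icc a b) t₀ := by
    have h1 := ((hγ t₀ ht₀).mdifferentiableWithinAt one_ne_zero).hasMFDerivWithinAt
    have h2 := (mdifferentiableAt_extChartAt (I := 𝓡 n)
      (mem_chart_source (EuclideanSpace ℝ (Fin n)) (γ t₀))).hasMFDerivAt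
    rw [mfderiv_extChartAt_self] at h2
    have h3 : HasFDerivWithinAt (fun t ↦ φ (γ t)) (ContinuousLinearMap.toSpanSingleton ℝ v₀)
        (Icc a b) t₀ := by
      refine HasFDerivWithinAt.congr_fderiv
        (h2.comp_hasMFDerivWithinAt t₀ h1).hasFDerivWithinAt ?_
      refine ContinuousLinearMap.ext_ring ?_
      exact (one_smul ℝ v₀).symm
    simpa using h3.hasDerivWithinAt
  have hslope := hasDerivWithinAt_iff_tendsto_slope.1 hd
  have hle : 𝓝[Icc a b \ {t₀}] t₀ ≤ 𝓝[Icc a b] t₀ := nhdsWithin_mono _ sdiff_subset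
  have hnear : ∀ᶠ z in 𝓝 (γ t₀), z ∈ φ.source ∧ φ z ∈ Metric.ball (φ (γ t₀)) ρ :=
    Filter.Eventually.and hsrc (hφc.eventually (Metric.ball_mem_nhds _ hρ))
  filter_upwards [hslope.eventually (Metric.ball_mem_nhds v₀ hρ),
    hle (hγc.eventually hnear)] with t hts htn
  constructor
  · intro hlt
    have hcont : ContinuousAt (fun z ↦ (t₀ - t)⁻¹ • (φ z - φ (γ t))) (γ t₀) :=
      by fun_prop
    have hval : (t₀ - t)⁻¹ • (φ (γ t₀) - φ (γ t)) ∈ Metric.ball v₀ ρ := by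
      rw [slope_comm] at hts; exact hts
    filter_upwards [hnear, hcont.eventually (Metric.isOpen_ball.mem_nhds hval)] with z hz hzv
    have hpos := sub_pos.2 hlt
    have heq : φ (γ t) + (t₀ - t) • ((t₀ - t)⁻¹ • (φ z - φ (γ t))) = φ z := by
      rw [smul_inv_smul₀ hpos.ne']; abel
    have := hseg (φ (γ t)) _ _ hpos htn.2 (by rw [heq]; exact hz.2) hzv
    rwa [heq, φ.left_inv htn.1, φ.left_inv hz.1] at this
  · intro hlt
    have hcont : ContinuousAt (fun z ↦ (t - t₀)⁻¹ • (φ (γ t) - φ z)) (γ t₀) :=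
      by fun_prop
    have hval : (t - t₀)⁻¹ • (φ (γ t) - φ (γ t₀)) ∈ Metric.ball v₀ ρ := hts
    filter_upwards [hnear, hcont.eventually (Metric.isOpen_ball.mem_nhds hval)] with z hz hzv
    have hpos := sub_pos.2 hlt
    have heq : φ z + (t - t₀) • ((t - t₀)⁻¹ • (φ (γ t) - φ z)) = φ (γ t) := by
      rw [smul_inv_smul₀ hpos.ne']; abel
    have := hseg (φ z) _ _ hpos hz.2 (by rw [heq]; exact htn.2) hzv
    rwa [heq, φ.left_inv htn.1, φ.left_inv hz.1] at this

/-- Follow the curve to a point shortly before its end, then a segment to `z`; only the last piece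
has to be changed. -/
lemma IsTimelikeCurve.eventually_chron_right (h : S.IsTimelikeCurve γ a b) :
    ∀ᶠ z in 𝓝 (γ b), S.Chron (γ a) z := by
  induction h with
  | @piece a b hab hs hv =>
    have hb : b ∈ Icc a b := right_mem_Icc.2 hab.le
    have hle : 𝓝[<] b ≤ 𝓝[Icc a b \ {b}] b := nhdsWithin_le_iff.2 <|
      Filter.mem_of_superset (Ico_mem_nhdsLT hab) fun t ht ↦ ⟨⟨ht.1, ht.2.le⟩, ht.2.ne⟩
    obtain ⟨t, ht, htI⟩ := (((eventually_chron_of_velocity hb hs (hv b hb)).filter_mono hle).and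
      (Ioo_mem_nhdsLT hab)).exists
    filter_upwards [ht.1 htI.2] with z hz
    exact (chron_of_subset hs hv htI.1 (Icc_subset_Icc_right htI.2.le)).trans hz
  | concat h₁ h₂ _ ih₂ =>
    filter_upwards [ih₂] with z hz
    exact Chron.trans ⟨γ, _, _, h₁, rfl, rfl⟩ hz

lemma IsTimelikeCurve.eventually_chron_left (h : S.IsTimelikeCurve γ a b) :
    ∀ᶠ z in 𝓝 (γ a), S.Chron z (γ b) := by
  induction h with
  | @piece a b hab hs hv =>
    have ha : a ∈ Icc a b := left_mem_Icc.2 hab.le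
    have hle : 𝓝[>] a ≤ 𝓝[Icc a b \ {a}] a := nhdsWithin_le_iff.2 <|
      Filter.mem_of_superset (Ioc_mem_nhdsGT hab) fun t ht ↦ ⟨⟨ht.1.le, ht.2⟩, ht.1.ne'⟩
    obtain ⟨t, ht, htI⟩ := (((eventually_chron_of_velocity ha hs (hv a ha)).filter_mono hle).and
      (Ioo_mem_nhdsGT hab)).exists
    filter_upwards [ht.2 htI.1] with z hz
    exact hz.trans (chron_of_subset hs hv htI.2 (Icc_subset_Icc_left htI.1.le))
  | concat h₁ h₂ ih₁ _ =>
    filter_upwards [ih₁] with z hz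
    exact hz.trans ⟨γ, _, _, h₂, rfl, rfl⟩

lemma isOpen_chronFuture (S : Spacetime n M) (p : M) : IsOpen (S.chronFuture p) := by
  rw [isOpen_iff_mem_nhds]
  rintro q ⟨γ, a, b, h, rfl, rfl⟩
  exact h.eventually_chron_right

lemma isOpen_chronPast (S : Spacetime n M) (p : M) : IsOpen (S.chronPast p) := by
  rw [isOpen_iff_mem_nhds]
  rintro q ⟨γ, a, b, h, rfl, rfl⟩
  exact h.eventually_chron_left

lemma mem_closure_chronPast_and_chronFuture (S : Spacetime n M) (x : M) :
    x ∈ closure (S.chronPast x) ∧ x ∈ closure (S.chronFuture x) := by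
  obtain ⟨v, hv⟩ := S.futureCone_nonempty x
  obtain ⟨ρ, hρ, hseg⟩ := exists_chron_segment (S := S) x hv
  set φ := extChartAt (𝓡 n) x
  let v' : EuclideanSpace ℝ (Fin n) := v
  have hφ : φ.symm (φ x) = x := extChartAt_to_inv x
  -- `σ = -1` gives approach from the past, `σ = 1` from the future.
  have htend : ∀ σ : ℝ, Filter.Tendsto (fun s : ℝ ↦ φ x + (σ * s) • v') (𝓝[>] 0) (𝓝 (φ x)) :=
    fun σ ↦ by
    have : ContinuousAt (fun s : ℝ ↦ φ x + (σ * s) • v') 0 := by fun_prop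
    simpa [ContinuousAt] using this.tendsto.mono_left (nhdsWithin_le_nhds (s := Ioi 0))
  have hsymm : Filter.Tendsto φ.symm (𝓝 (φ x)) (𝓝 x) := by
    have := (continuousAt_extChartAt_symm (I := 𝓡 n) x).tendsto
    rwa [extChartAt_to_inv] at this
  constructor
  · refine mem_closure_of_tendsto (hsymm.comp (htend (-1))) ?_
    filter_upwards [self_mem_nhdsWithin, (htend (-1)).eventually (Metric.ball_mem_nhds _ hρ)]
      with s hs hsm
    have heq : φ x + (-1 * s) • v' + s • v' = φ x := by simp
    have := hseg _ v' s hs hsm (by rw [heq]; exact Metric.mem_ball_self hρ)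
      (Metric.mem_ball_self hρ)
    rw [heq, hφ] at this
    exact this
  · refine mem_closure_of_tendsto (hsymm.comp (htend 1)) ?_
    filter_upwards [self_mem_nhdsWithin, (htend 1).eventually (Metric.ball_mem_nhds _ hρ)]
      with s hs hsm
    rw [one_mul] at hsm
    have := hseg _ v' s hs (Metric.mem_ball_self hρ) hsm (Metric.mem_ball_self hρ)
    rw [hφ] at this
    simpa [chronFuture] using this

end Openness

end Spacetime

/-! ### Perturbing causal curves into timelike ones -/

section Perturbation

variable {E : Type*} [NormedAddCommGroup E] [NormedSpace ℝ E]

/-- Displacing a causal curve `c` in the direction of a timelike vector `T`, at a rate that dominates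
the displacement, makes it timelike. -/
lemma exists_rate_forall_perturbation_neg {G : E → E →L[ℝ] E →L[ℝ] ℝ} {T y₀ : E} {r : ℝ}
    {L : NNReal} (hsymm : ∀ y v w, G y v w = G y w v)
    (hlip : LipschitzOnWith L G (Metric.ball y₀ r)) (hT : ∀ y ∈ Metric.ball y₀ r, G y T T < 0)
    {a b : ℝ} (hab : a ≤ b) {c c' : ℝ → E} (hc : ContinuousOn c (Icc a b))
    (hc' : ContinuousOn c' (Icc a b)) (hmaps : MapsTo c (Icc a b) (Metric.ball y₀ r))
    (h1 : ∀ t ∈ Icc a b, G (c t) (c' t) (c' t) ≤ 0) (h2 : ∀ t ∈ Icc a b, G (c t) T (c' t) < 0) :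
    ∃ k : ℝ, 0 < k ∧ ∀ f g : ℝ → ℝ, ContinuousOn f (Icc a b) →
      (∀ t ∈ Icc a b, 0 < g t ∧ k * |f t| ≤ g t) →
      ∀ᶠ ε : ℝ in 𝓝[>] 0, ∀ t ∈ Icc a b, c t + (ε * f t) • T ∈ Metric.ball y₀ r ∧
        G (c t + (ε * f t) • T) (c' t + (ε * g t) • T) (c' t + (ε * g t) • T) < 0 ∧
        G (c t + (ε * f t) • T) T (c' t + (ε * g t) • T) < 0 := by
  let _ : SeminormedAddCommGroup (E →L[ℝ] E →L[ℝ] ℝ) :=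
    ContinuousLinearMap.toSeminormedAddCommGroup
  have hne : (Icc a b).Nonempty := nonempty_Icc.2 hab
  obtain ⟨C, hC⟩ := isCompact_Icc.exists_bound_of_continuousOn hc'
  have hC0 : 0 ≤ C := (norm_nonneg _).trans (hC a (left_mem_Icc.2 hab))
  have hGc : ContinuousOn (fun t ↦ G (c t) T (c' t)) (Icc a b) :=
    ((hlip.continuousOn.comp hc hmaps).clm_apply continuousOn_const).clm_apply hc'
  obtain ⟨t₁, ht₁, hmax⟩ := isCompact_Icc.exists_isMaxOn hne hGc
  have hdc : ContinuousOn (fun t ↦ dist (c t) y₀) (Icc a b) := by fun_prop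
  obtain ⟨t₂, ht₂, hmax₂⟩ := isCompact_Icc.exists_isMaxOn hne hdc
  set δ := -G (c t₁) T (c' t₁)
  have hδ : 0 < δ := neg_pos.2 (h2 t₁ ht₁)
  have hδ' : ∀ t ∈ Icc a b, G (c t) T (c' t) ≤ -δ := fun t ht ↦ by
    rw [neg_neg]; exact hmax ht
  set η := r - dist (c t₂) y₀
  have hη : 0 < η := sub_pos.2 (hmaps ht₂)
  have hη' : ∀ t ∈ Icc a b, dist (c t) y₀ ≤ r - η := fun t ht ↦ by
    rw [sub_sub_cancel]; exact hmax₂ ht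
  set A : ℝ := L * ‖T‖ * C ^ 2
  have hA : 0 ≤ A := by positivity
  -- Displacement by `ε f T` raises `G(c', c')` by at most `ε A |f|`, while the cross term with `ε g
  -- T` lowers it by at least `ε δ g`; hence the ratio `A / δ`. The summand `1` keeps the rate
  -- positive when `A = 0`.
  refine ⟨A / δ + 1, by positivity, fun f g hf hfg ↦ ?_⟩
  obtain ⟨F, hF⟩ := isCompact_Icc.exists_bound_of_continuousOn hf
  -- The first smallness condition keeps the displaced curve in the ball, the second keeps `G(T,
  -- c')` below `-δ / 2`.
  have e1 : ∀ᶠ ε : ℝ in 𝓝[>] 0, ε * (F * ‖T‖) < η := by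
    have : ContinuousAt (fun ε : ℝ ↦ ε * (F * ‖T‖)) 0 := by fun_prop
    exact (this.eventually_lt_const (by simpa using hη)).filter_mono nhdsWithin_le_nhds
  have e2 : ∀ᶠ ε : ℝ in 𝓝[>] 0, ε * (L * F * ‖T‖ * ‖T‖ * C) < δ / 2 := by
    have : ContinuousAt (fun ε : ℝ ↦ ε * (L * F * ‖T‖ * ‖T‖ * C)) 0 := by fun_prop
    exact (this.eventually_lt_const (by simpa using hδ)).filter_mono nhdsWithin_le_nhds
  have hF0 : 0 ≤ F := (norm_nonneg _).trans (hF a (left_mem_Icc.2 hab))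
  filter_upwards [e1, e2, self_mem_nhdsWithin] with ε hε1 hε2 hε t ht
  have hε : 0 < ε := hε
  obtain ⟨hg0, hg⟩ := hfg t ht
  have hfF : |f t| ≤ F := hF t ht
  have hnorm : ‖(ε * f t) • T‖ = ε * |f t| * ‖T‖ := by
    rw [norm_smul, Real.norm_eq_abs, abs_mul, abs_of_pos hε]
  set z := c t + (ε * f t) • T
  have hdist : dist z (c t) = ε * |f t| * ‖T‖ := by
    rw [dist_eq_norm, add_sub_cancel_left, hnorm]
  have hz : z ∈ Metric.ball y₀ r := by
    have h3 : ε * |f t| * ‖T‖ ≤ ε * (F * ‖T‖) := by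
      rw [mul_assoc]; gcongr
    have h4 := dist_triangle z (c t) y₀
    have h5 := hη' t ht
    rw [Metric.mem_ball]
    linarith
  have hdiff : ∀ v w : E, G z v w ≤ G (c t) v w + L * (ε * |f t| * ‖T‖) * ‖v‖ * ‖w‖ :=
    fun v w ↦ by
    have h3 : ‖G z - G (c t)‖ ≤ L * (ε * |f t| * ‖T‖) := by
      rw [← hdist, dist_eq_norm z]; exact hlip.norm_sub_le hz (hmaps ht)
    have h4 := (le_abs_self _).trans ((G z - G (c t)).le_opNorm₂ v w)
    have h5 : (G z - G (c t)) v w = G z v w - G (c t) v w := rfl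
    have h6 : ‖G z - G (c t)‖ * ‖v‖ * ‖w‖ ≤ L * (ε * |f t| * ‖T‖) * ‖v‖ * ‖w‖ := by gcongr
    linarith
  have hCt := hC t ht
  have hzcc : G z (c' t) (c' t) ≤ ε * (A * |f t|) := by
    have h3 := hdiff (c' t) (c' t)
    have h4 : L * (ε * |f t| * ‖T‖) * ‖c' t‖ * ‖c' t‖ ≤ L * (ε * |f t| * ‖T‖) * C * C := by gcongr
    have h5 := h1 t ht
    have h6 : L * (ε * |f t| * ‖T‖) * C * C = ε * (A * |f t|) := by simp only [A]; ring
    linarith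
  have hzT : G z T (c' t) < -δ / 2 := by
    have h3 := hdiff T (c' t)
    have h4 : L * (ε * |f t| * ‖T‖) * ‖T‖ * ‖c' t‖ ≤ L * (ε * F * ‖T‖) * ‖T‖ * C := by gcongr
    have h5 := hδ' t ht
    have h6 : L * (ε * F * ‖T‖) * ‖T‖ * C = ε * (L * F * ‖T‖ * ‖T‖ * C) := by ring
    linarith
  have hzTT := hT z hz
  have hεg : 0 < ε * g t := mul_pos hε hg0
  refine ⟨hz, ?_, ?_⟩
  · have hexp : G z (c' t + (ε * g t) • T) (c' t + (ε * g t) • T) =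
        G z (c' t) (c' t) + 2 * (ε * g t) * G z T (c' t) + (ε * g t) ^ 2 * G z T T := by
      simp only [map_add, map_smul, add_apply, smul_apply, smul_eq_mul, hsymm z (c' t) T]
      ring
    have h3 : A * |f t| ≤ δ * g t := by
      have h4 := mul_le_mul_of_nonneg_left hg hδ.le
      have h5 : δ * ((A / δ + 1) * |f t|) = A * |f t| + δ * |f t| := by field_simp
      have h6 : 0 ≤ δ * |f t| := by positivity
      linarith
    have h4 : ε * (A * |f t|) ≤ ε * (δ * g t) := by gcongr
    have h5 : 2 * (ε * g t) * G z T (c' t) ≤ 2 * (ε * g t) * (-δ / 2) := by gcongr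
    have h6 : (ε * g t) ^ 2 * G z T T < 0 := mul_neg_of_pos_of_neg (by positivity) hzTT
    rw [hexp]
    linarith
  · have hexp : G z T (c' t + (ε * g t) • T) = G z T (c' t) + ε * g t * G z T T := by
      simp
    have h6 : ε * g t * G z T T < 0 := mul_neg_of_pos_of_neg hεg hzTT
    rw [hexp]
    linarith

end Perturbation

/-! ### The push-up property -/

namespace Spacetime

variable {n : ℕ} {M : Type*} [TopologicalSpace M]
  [ChartedSpace (EuclideanSpace ℝ (Fin n)) M] [IsManifold (𝓡 n) ∞ M]
  {S : Spacetime n M} {x₀ : M} {γ : ℝ → M} {a b : ℝ}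

/-- Each of two points is a limit of points that are chronologically related to the other. -/
def ClosureChron (S : Spacetime n M) (x y : M) : Prop :=
  x ∈ closure (S.chronPast y) ∧ y ∈ closure (S.chronFuture x)

lemma closureChron_refl (S : Spacetime n M) (x : M) : S.ClosureChron x x :=
  S.mem_closure_chronPast_and_chronFuture x

/-- `I⁺(x)` is an open neighborhood of `y`, which is a limit of points of `I⁻(z)`, so the two sets
meet. -/
lemma Chron.trans_closureChron {x y z : M} (h : S.Chron x y) (h' : S.ClosureChron y z) :
    S.Chron x z := by
  obtain ⟨w, hw, hw'⟩ := mem_closure_iff.1 h'.1 _ (S.isOpen_chronFuture x) h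
  exact Chron.trans hw hw'

lemma ClosureChron.trans_chron {x y z : M} (h : S.ClosureChron x y) (h' : S.Chron y z) :
    S.Chron x z := by
  obtain ⟨w, hw, hw'⟩ := mem_closure_iff.1 h.2 _ (S.isOpen_chronPast z) h'
  exact Chron.trans hw' hw

lemma ClosureChron.trans {x y z : M} (h : S.ClosureChron x y) (h' : S.ClosureChron y z) :
    S.ClosureChron x z :=
  ⟨closure_mono (fun _ hw ↦ Chron.trans_closureChron hw h') h.1,
    closure_mono (fun _ hw ↦ h.trans_chron hw) h'.2⟩

/-- The curve is displaced with one endpoint fixed. The displaced curves are timelike and their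
other endpoint converges to the original one as `ε → 0`. -/
lemma IsAdaptedBall.closureChron {r : ℝ} {K : NNReal} {T : EuclideanSpace ℝ (Fin n)}
    (h : S.IsAdaptedBall x₀ r K T) (hab : a < b)
    (hγ : ContMDiffOn 𝓘(ℝ, ℝ) (𝓡 n) 1 γ (Icc a b))
    (hv : ∀ t ∈ Icc a b, S.IsFutureCausal (γ t) (velocity n γ a b t))
    (hsrc : MapsTo γ (Icc a b) (extChartAt (𝓡 n) x₀).source)
    (hball : MapsTo (fun t ↦ extChartAt (𝓡 n) x₀ (γ t)) (Icc a b)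
      (Metric.ball (extChartAt (𝓡 n) x₀ x₀) r)) : S.ClosureChron (γ a) (γ b) := by
  set φ := extChartAt (𝓡 n) x₀
  set c : ℝ → EuclideanSpace ℝ (Fin n) := fun t ↦ φ (γ t)
  have hc : ContDiffOn ℝ 1 c (Icc a b) := contDiffOn_extChartAt_comp hγ hsrc
  set c' := derivWithin c (Icc a b)
  have hc' : ContinuousOn c' (Icc a b) :=
    hc.continuousOn_derivWithin (uniqueDiffOn_Icc hab) le_rfl
  have hd : ∀ t ∈ Icc a b, HasDerivWithinAt c (c' t) (Icc a b) t := fun t ht ↦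
    ((hc t ht).differentiableWithinAt one_ne_zero).hasDerivWithinAt
  have hinv : EqOn γ (fun t ↦ φ.symm (c t)) (Icc a b) := fun t ht ↦ (φ.left_inv (hsrc ht)).symm
  have hinv' : ∀ t ∈ Icc a b, φ.symm (c t) = γ t := fun t ht ↦ φ.left_inv (hsrc ht)
  have hcausal : ∀ t ∈ Icc a b, S.coordMetric x₀ (c t) (c' t) (c' t) ≤ 0 ∧
      S.coordMetric x₀ (c t) T (c' t) < 0 := fun t ht ↦ by
    have h1 := (isFutureCausal_velocity_congr hinv ht).1 (hv t ht)
    rw [velocity_extChartAt_symm_comp hab ht hc (hball.mono_right h.subset)] at h1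
    exact h.of_isFutureCausal (hball ht) h1
  obtain ⟨k, hk, hpert⟩ := exists_rate_forall_perturbation_neg (S.coordMetric_symm x₀) h.lipschitz
    (fun y hy ↦ h.coordMetric_self_neg hy) hab.le hc.continuousOn hc' hball
    (fun t ht ↦ (hcausal t ht).1) (fun t ht ↦ (hcausal t ht).2)
  have key : ∀ f g : ℝ → ℝ, ContDiff ℝ 1 f → (∀ t, HasDerivAt f (g t) t) →
      (∀ t ∈ Icc a b, 0 < g t ∧ k * |f t| ≤ g t) → ∀ᶠ ε : ℝ in 𝓝[>] 0,
        S.Chron (φ.symm (c a + (ε * f a) • T)) (φ.symm (c b + (ε * f b) • T)) :=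
    fun f g hf hfg hg ↦ by
    filter_upwards [hpert f g hf.continuous.continuousOn hg] with ε hε
    refine h.chron_of_curve (c := fun t ↦ c t + (ε * f t) • T)
      (c' := fun t ↦ c' t + (ε * g t) • T) hab
      (hc.add ((contDiff_const.mul hf).smul contDiff_const).contDiffOn)
      (fun t ht ↦ (hd t ht).add (((hfg t).const_mul ε).smul_const T).hasDerivWithinAt)
      (fun t ht ↦ (hε t ht).1) (fun t ht ↦ (hε t ht).2.1) (fun t ht ↦ (hε t ht).2.2)
  have htend : ∀ t ∈ Icc a b, ∀ m : ℝ,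
      Filter.Tendsto (fun ε : ℝ ↦ φ.symm (c t + (ε * m) • T)) (𝓝[>] 0) (𝓝 (γ t)) :=
    fun t ht m ↦ by
    have h1 : ContinuousAt (fun ε : ℝ ↦ c t + (ε * m) • T) 0 := by fun_prop
    have h2 : ContinuousAt φ.symm (c t + ((0 : ℝ) * m) • T) := by
      rw [zero_mul, zero_smul, add_zero]
      exact continuousAt_extChartAt_symm' (hsrc ht)
    have h3 := (ContinuousAt.comp (f := fun ε : ℝ ↦ c t + (ε * m) • T) h2 h1).tendsto
    simp only [Function.comp_def, zero_mul, zero_smul, add_zero] at h3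
    rw [hinv' t ht] at h3
    exact h3.mono_left nhdsWithin_le_nhds
  have ha := left_mem_Icc.2 hab.le
  have hb := right_mem_Icc.2 hab.le
  constructor
  -- This `f` vanishes at `b` and satisfies `f' ≥ k |f|` on the interval.
  · have h1 := key (fun t ↦ 1 - Real.exp (k * (b - t))) (fun t ↦ k * Real.exp (k * (b - t)))
      (by fun_prop) (fun t ↦ by
        have h2 := ((((hasDerivAt_id t).const_sub b).const_mul k).exp).const_sub 1
        exact h2.congr_deriv (by simp only [id]; ring)) (fun t ht ↦ by
        have h2 : 1 ≤ Real.exp (k * (b - t)) :=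
          Real.one_le_exp (mul_nonneg hk.le (sub_nonneg.2 ht.2))
        refine ⟨by positivity, mul_le_mul_of_nonneg_left ?_ hk.le⟩
        rw [abs_le]
        constructor <;> linarith)
    refine mem_closure_of_tendsto (htend a ha (1 - Real.exp (k * (b - a)))) ?_
    filter_upwards [h1] with ε hε
    simp only [sub_self, mul_zero, Real.exp_zero, zero_smul, add_zero] at hε
    rw [hinv' b hb] at hε
    exact hε
  -- The mirror image: `f` vanishes at `a`.
  · have h1 := key (fun t ↦ Real.exp (k * (t - a)) - 1) (fun t ↦ k * Real.exp (k * (t - a)))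
      (by fun_prop) (fun t ↦ by
        have h2 := ((((hasDerivAt_id t).sub_const a).const_mul k).exp).sub_const 1
        exact h2.congr_deriv (by simp only [id]; ring)) (fun t ht ↦ by
        have h2 : 1 ≤ Real.exp (k * (t - a)) :=
          Real.one_le_exp (mul_nonneg hk.le (sub_nonneg.2 ht.1))
        refine ⟨by positivity, mul_le_mul_of_nonneg_left ?_ hk.le⟩
        rw [abs_le]
        constructor <;> linarith)
    refine mem_closure_of_tendsto (htend b hb (Real.exp (k * (b - a)) - 1)) ?_
    filter_upwards [h1] with ε hε
    simp only [sub_self, mul_zero, Real.exp_zero, zero_smul, add_zero] at hε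
    rw [hinv' a ha] at hε
    exact hε

/-- By compactness a `C¹` piece splits into finitely many arcs lying in adapted balls, and
`ClosureChron` is transitive. -/
lemma IsCausalCurve.closureChron (h : S.IsCausalCurve γ a b) : S.ClosureChron (γ a) (γ b) := by
  induction h with
  | @piece a b hab hγ hv =>
    choose r K T hAd using S.exists_isAdaptedBall
    let W : M → Set M := fun x ↦ (extChartAt (𝓡 n) x).source ∩
      extChartAt (𝓡 n) x ⁻¹' Metric.ball (extChartAt (𝓡 n) x x) (r x)
    have hWo : ∀ x, IsOpen (W x) := fun x ↦
      (continuousOn_extChartAt x).isOpen_inter_preimage (isOpen_extChartAt_source x)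
        Metric.isOpen_ball
    have hWm : ∀ x, x ∈ W x := fun x ↦
      ⟨mem_extChartAt_source x, Metric.mem_ball_self (hAd x).pos⟩
    have hcont : Continuous (fun t : Icc a b ↦ γ t) := hγ.continuousOn.domRestrict
    obtain ⟨t, ht0, hmono, ⟨m, hm⟩, hcov⟩ := exists_monotone_Icc_subset_open_cover_Icc hab.le
      (c := fun x ↦ (fun t : Icc a b ↦ γ t) ⁻¹' W x) (fun x ↦ (hWo x).preimage hcont)
      (fun s _ ↦ mem_iUnion.2 ⟨γ s, hWm _⟩)
    have hind : ∀ j, S.ClosureChron (γ a) (γ (t j)) := fun j ↦ by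
      induction j with
      | zero => rw [ht0]; exact S.closureChron_refl _
      | succ j ih =>
        refine ih.trans ?_
        obtain ⟨x, hx⟩ := hcov j
        have hsub : Icc (t j : ℝ) (t (j + 1)) ⊆ Icc a b :=
          Icc_subset_Icc (t j).2.1 (t (j + 1)).2.2
        -- The subdivision is only weakly monotone; repeated points are handled by reflexivity.
        rcases (hmono j.le_succ).eq_or_lt with heq | hlt
        · rw [← Nat.succ_eq_add_one, ← heq]; exact S.closureChron_refl _
        · have hlt' : (t j : ℝ) < t (j + 1) := hlt
          have hW : ∀ s ∈ Icc (t j : ℝ) (t (j + 1)), γ s ∈ W x := fun s hs ↦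
            @hx ⟨s, hsub hs⟩ hs
          exact (hAd x).closureChron hlt' (hγ.mono hsub)
            (fun s hs ↦ by
              rw [velocity_eq_of_subset hlt' hsub hγ hs]; exact hv s (hsub hs))
            (fun s hs ↦ (hW s hs).1) (fun s hs ↦ (hW s hs).2)
    simpa [hm m le_rfl] using hind m
  | concat _ _ ih₁ ih₂ => exact ih₁.trans ih₂

lemma Causal.closureChron {p q : M} (h : S.Causal p q) : S.ClosureChron p q := by
  rcases h with rfl | ⟨γ, a, b, h, rfl, rfl⟩
  · exact S.closureChron_refl p
  · exact h.closureChron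

lemma Chron.trans_causal {p q r : M} (h : S.Chron p q) (h' : S.Causal q r) : S.Chron p r :=
  h.trans_closureChron h'.closureChron

lemma Causal.trans_chron {p q r : M} (h : S.Causal p q) (h' : S.Chron q r) : S.Chron p r :=
  h.closureChron.trans_chron h'

end Spacetime

/-! ### Indecomposable past sets and their topology -/

namespace Spacetime

variable {n : ℕ} {M : Type*} [TopologicalSpace M]
  [ChartedSpace (EuclideanSpace ℝ (Fin n)) M] [IsManifold (𝓡 n) ∞ M] {S : Spacetime n M}

lemma IsPastSet.mem_of_chron {U : Set M} (hU : S.IsPastSet U) {x y : M} (h : S.Chron x y)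
    (hy : y ∈ U) : x ∈ U :=
  hU.2 (mem_iUnion₂.2 ⟨y, hy, h⟩)

lemma isPastSet_biUnion_chronPast (S : Spacetime n M) (A : Set M) :
    S.IsPastSet (⋃ p ∈ A, S.chronPast p) := by
  refine ⟨isOpen_biUnion fun p _ ↦ S.isOpen_chronPast p, fun x hx ↦ ?_⟩
  simp only [mem_iUnion] at hx ⊢
  obtain ⟨y, ⟨p, hp, hy⟩, hx⟩ := hx
  exact ⟨p, hp, Chron.trans hx hy⟩

lemma isPastSet_chronPast (S : Spacetime n M) (p : M) : S.IsPastSet (S.chronPast p) := by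
  simpa using S.isPastSet_biUnion_chronPast {p}

lemma IsPastSet.exists_chron {U : Set M} (hU : S.IsPastSet U) {x : M} (hx : x ∈ U) :
    ∃ y ∈ U, S.Chron x y :=
  mem_closure_iff.1 (S.mem_closure_chronPast_and_chronFuture x).2 U hU.1 hx

lemma IsPastSet.mem_of_chron_of_mem_closure {U : Set M} (hU : S.IsPastSet U) {x y : M}
    (h : S.Chron x y) (hy : y ∈ closure U) : x ∈ U := by
  obtain ⟨z, hz, hzU⟩ := mem_closure_iff.1 hy _ (S.isOpen_chronFuture x) h
  exact hU.mem_of_chron hz hzU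

/-- Every point of `U` lies in the past of another point of `U`, which is a limit of points of `V`.
-/
lemma IsPastSet.subset_of_subset_closure {U V : Set M} (hU : S.IsPastSet U) (hV : S.IsPastSet V)
    (h : U ⊆ closure V) : U ⊆ V := fun _ hx ↦ by
  obtain ⟨y, hy, hxy⟩ := hU.exists_chron hx
  exact hV.mem_of_chron_of_mem_closure hxy (h hy)

/-- An indecomposable past set is directed for the chronology relation. -/
lemma IP.exists_chron_chron (P : S.IP) {p q : M} (hp : p ∈ P.carrier) (hq : q ∈ P.carrier) :
    ∃ r ∈ P.carrier, S.Chron p r ∧ S.Chron q r := by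
  -- Points of `P` are sorted by whether they lie in `I⁺(p)`. The past of those that do not cannot
  -- contain `p`, so the past of those that do is all of `P`.
  have hcover : P.carrier = (⋃ y ∈ P.carrier ∩ S.chronFuture p, S.chronPast y) ∪
      ⋃ y ∈ P.carrier \ S.chronFuture p, S.chronPast y := by
    rw [← biUnion_union, inter_union_sdiff]
    refine Subset.antisymm (fun x hx ↦ ?_) P.isPastSet.2
    obtain ⟨y, hy, hxy⟩ := P.isPastSet.exists_chron hx
    exact mem_iUnion₂.2 ⟨y, hy, hxy⟩
  rcases P.indecomposable _ _ (S.isPastSet_biUnion_chronPast _) (S.isPastSet_biUnion_chronPast _)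
    hcover with h | h
  · rw [← h] at hq
    obtain ⟨r, hr, hqr⟩ := mem_iUnion₂.1 hq
    exact ⟨r, hr.1, hr.2, hqr⟩
  · rw [← h] at hp
    obtain ⟨r, hr, hpr⟩ := mem_iUnion₂.1 hp
    exact absurd hpr hr.2

lemma IP.exists_forall_chron (P : S.IP) {A : Set M} (hA : A.Finite) (hAP : A ⊆ P.carrier) :
    ∃ r ∈ P.carrier, ∀ p ∈ A, S.Chron p r := by
  induction A, hA using Set.Finite.induction_on with
  | empty => exact ⟨_, P.nonempty.some_mem, by simp⟩
  | @insert a A _ _ ih =>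
    obtain ⟨r, hr, hAr⟩ := ih ((subset_insert _ _).trans hAP)
    obtain ⟨s, hs, has, hrs⟩ := P.exists_chron_chron (hAP (mem_insert _ _)) hr
    refine ⟨s, hs, ?_⟩
    rintro p (rfl | hp)
    exacts [has, (hAr p hp).trans hrs]

/-- The chronological past of a point, as an indecomposable past set. -/
def pip (S : Spacetime n M) (p : M) : S.IP where
  carrier := S.chronPast p
  nonempty := closure_nonempty_iff.1 ⟨p, (S.mem_closure_chronPast_and_chronFuture p).1⟩
  isPastSet := S.isPastSet_chronPast p
  indecomposable V W hV hW h := by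
    -- `p` is in the closure of one of the two pieces, and that piece then contains all of `I⁻(p)`.
    have hp := (S.mem_closure_chronPast_and_chronFuture p).1
    rw [h, closure_union] at hp
    rcases hp with hp | hp
    · exact Or.inl (Subset.antisymm (h ▸ subset_union_left)
        fun x hx ↦ hV.mem_of_chron_of_mem_closure hx hp)
    · exact Or.inr (Subset.antisymm (h ▸ subset_union_right)
        fun x hx ↦ hW.mem_of_chron_of_mem_closure hx hp)

lemma IP.ext_carrier {P Q : S.IP} (h : P.carrier = Q.carrier) : P = Q := by
  cases P; cases Q; congr

lemma isTopologicalBasis_finite_inter_subbasis (S : Spacetime n M) : IsTopologicalBasis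
    {O : Set S.IP | ∃ F : Set (Set S.IP), F.Finite ∧ F ⊆ S.subbasis ∧ O = ⋂₀ F} := by
  convert isTopologicalBasis_of_subbasis (α := S.IP) (s := S.subbasis) rfl using 1
  ext O
  simp only [mem_ofPred_eq, mem_image]
  exact ⟨fun ⟨F, h1, h2, h3⟩ ↦ ⟨F, ⟨h1, h2⟩, h3.symm⟩, fun ⟨F, ⟨h1, h2⟩, h3⟩ ↦ ⟨F, h1, h2, h3.symm⟩⟩

lemma IP.exists_disjoint_of_not_subset {P Q : S.IP} (h : ¬ P.carrier ⊆ Q.carrier) :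
    ∃ u v : Set S.IP, IsOpen u ∧ IsOpen v ∧ P ∈ u ∧ Q ∈ v ∧ Disjoint u v := by
  obtain ⟨p, hpP, hpQ⟩ := not_subset.1 (mt (P.isPastSet.subset_of_subset_closure Q.isPastSet) h)
  obtain ⟨p', hp'P, hpp'⟩ := P.isPastSet.exists_chron hpP
  refine ⟨S.meeting (S.chronFuture p'), S.inside (S.causalFuture p')ᶜ,
    isOpen_generateFrom_of_mem ⟨p', Or.inl rfl⟩,
    isOpen_generateFrom_of_mem ⟨p', Or.inr (Or.inr (Or.inr rfl))⟩, ?_, ?_, ?_⟩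
  · obtain ⟨y, hy, hxy⟩ := P.isPastSet.exists_chron hp'P
    exact ⟨y, hy, hxy⟩
  · intro x hx hx'
    exact hpQ (subset_closure
      (Q.isPastSet.mem_of_chron_of_mem_closure (hpp'.trans_causal hx') hx))
  · rw [Set.disjoint_left]
    rintro R ⟨y, hy, hxy⟩ hR
    -- A past set meeting `I⁺(p')` contains `p'`, and `p' ∈ J⁺(p')`.
    exact hR (subset_closure (R.isPastSet.mem_of_chron hxy hy)) (Or.inl rfl)

lemma t2Space_IP (S : Spacetime n M) : T2Space S.IP := by
  refine ⟨fun P Q hPQ ↦ ?_⟩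
  by_cases h : P.carrier ⊆ Q.carrier
  · have h' : ¬ Q.carrier ⊆ P.carrier := fun h' ↦ hPQ (IP.ext_carrier (h.antisymm h'))
    obtain ⟨u, v, hu, hv, hQ, hP, hd⟩ := IP.exists_disjoint_of_not_subset h'
    exact ⟨v, u, hv, hu, hP, hQ, hd.symm⟩
  · exact IP.exists_disjoint_of_not_subset h

/-- A condition of meeting `U` passes to `I⁻(p)` once `p` is beyond a witness `q ∈ P ∩ U`. A
condition on the closure passes to every `p ∈ P`, since `I⁻(p) ⊆ P`. -/
lemma exists_chron_forall_mem (P : S.IP) {O : Set S.IP} (hO : O ∈ S.subbasis) (hP : P ∈ O) :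
    ∃ q ∈ P.carrier, ∀ p ∈ P.carrier, S.Chron q p → S.pip p ∈ O := by
  have hmeet : ∀ U : Set M, P ∈ S.meeting U →
      ∃ q ∈ P.carrier, ∀ p ∈ P.carrier, S.Chron q p → S.pip p ∈ S.meeting U := by
    rintro U ⟨q, hqP, hqU⟩
    exact ⟨q, hqP, fun p _ hqp ↦ ⟨q, hqp, hqU⟩⟩
  have hin : ∀ U : Set M, P ∈ S.inside U →
      ∃ q ∈ P.carrier, ∀ p ∈ P.carrier, S.Chron q p → S.pip p ∈ S.inside U := by
    intro U hU
    obtain ⟨q, hq⟩ := P.nonempty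
    exact ⟨q, hq, fun p hp _ ↦
      (closure_mono fun x hx ↦ P.isPastSet.mem_of_chron hx hp).trans hU⟩
  obtain ⟨p, rfl | rfl | rfl | rfl⟩ := hO
  exacts [hmeet _ hP, hmeet _ hP, hin _ hP, hin _ hP]

lemma dense_PIPs (S : Spacetime n M) : Dense S.PIPs := by
  rw [S.isTopologicalBasis_finite_inter_subbasis.dense_iff]
  rintro _ ⟨F, hF, hsub, rfl⟩ ⟨P, hP⟩
  have : Nonempty M := ⟨P.nonempty.some⟩
  choose! q hqP hq using fun (O : Set S.IP) (hO : O ∈ F) ↦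
    exists_chron_forall_mem P (hsub hO) (hP O hO)
  obtain ⟨r, hr, hqr⟩ := P.exists_forall_chron (hF.image q) (image_subset_iff.2 hqP)
  exact ⟨S.pip r, fun O hO ↦ hq O hO r hr (hqr _ (mem_image_of_mem q hO)), r, rfl⟩

/-! ### Compact causal diamonds and openness of the PIPs -/

section CompactDiamonds

variable [T2Space M] (hS : ∀ p q : M, IsCompact (S.causalPast p ∩ S.causalFuture q))
include hS

/-- For `y ≪ x`, the part of `I⁻(p)` in the neighborhood `I⁺(y)` of `x` lies in a compact, hence
closed, diamond. -/
lemma closure_chronPast_subset_causalPast (p : M) :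
    closure (S.chronPast p) ⊆ S.causalPast p := by
  intro x hx
  obtain ⟨y, hy⟩ := (S.pip x).nonempty
  have h1 : x ∈ closure (S.chronFuture y ∩ S.chronPast p) :=
    (S.isOpen_chronFuture y).inter_closure ⟨hy, hx⟩
  have h2 : S.chronFuture y ∩ S.chronPast p ⊆ S.causalPast p ∩ S.causalFuture y :=
    fun z hz ↦ ⟨Chron.causal hz.2, Chron.causal hz.1⟩
  exact (closure_minimal h2 (hS p y).isClosed h1).1

/-- With compact causal diamonds, an indecomposable past set whose closure is bounded in the future
is the past of a point. -/
lemma mem_PIPs_of_mem_inside_chronPast {P : S.IP} {r : M} (hP : P ∈ S.inside (S.chronPast r)) :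
    P ∈ S.PIPs := by
  -- A common point of these sets is the vertex sought: being in `J⁺(y)` for all `y ∈ P` gives `P ⊆
  -- I⁻(x)` by push-up, and being in the closure of `P` gives the converse. Directedness of `P`
  -- makes the family directed.
  let D : P.carrier → Set M := fun y ↦
    S.causalPast r ∩ S.causalFuture y ∩ closure P.carrier
  have : Nonempty P.carrier := P.nonempty.to_subtype
  have hdir : Directed (· ⊇ ·) D := fun y z ↦ by
    obtain ⟨w, hw, hyw, hzw⟩ := P.exists_chron_chron y.2 z.2
    exact ⟨⟨w, hw⟩, fun x hx ↦ ⟨⟨hx.1.1, (hyw.trans_causal hx.1.2).causal⟩, hx.2⟩,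
      fun x hx ↦ ⟨⟨hx.1.1, (hzw.trans_causal hx.1.2).causal⟩, hx.2⟩⟩
  obtain ⟨x, hx⟩ := IsCompact.nonempty_iInter_of_directed_nonempty_isCompact_isClosed D hdir
    (fun y ↦ ⟨y, ⟨Chron.causal (hP (subset_closure y.2)), Or.inl rfl⟩, subset_closure y.2⟩)
    (fun y ↦ (hS r y).inter_right isClosed_closure)
    (fun y ↦ (hS r y).isClosed.inter isClosed_closure)
  rw [mem_iInter] at hx
  refine ⟨x, Subset.antisymm (fun y hy ↦ ?_) fun y hy ↦
    P.isPastSet.mem_of_chron_of_mem_closure hy (hx (Classical.arbitrary _)).2⟩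
  obtain ⟨z, hz, hyz⟩ := P.isPastSet.exists_chron hy
  exact hyz.trans_causal (hx ⟨z, hz⟩).1.2

lemma isOpen_PIPs : IsOpen S.PIPs := by
  rw [isOpen_iff_forall_mem_open]
  rintro P ⟨p, hp⟩
  obtain ⟨r, hr⟩ := closure_nonempty_iff.1 ⟨p, (S.mem_closure_chronPast_and_chronFuture p).2⟩
  refine ⟨S.inside (S.chronPast r), fun Q hQ ↦ mem_PIPs_of_mem_inside_chronPast hS hQ,
    isOpen_generateFrom_of_mem ⟨r, Or.inr (Or.inr (Or.inl rfl))⟩, fun x hx ↦ ?_⟩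
  rw [hp] at hx
  exact Causal.trans_chron (closure_chronPast_subset_causalPast hS p hx) hr

end CompactDiamonds

end Spacetime

theorem proposition5 {n : ℕ} {M : Type*} [TopologicalSpace M] [T2Space M]
    [SecondCountableTopology M] [ChartedSpace (EuclideanSpace ℝ (Fin n)) M]
    [IsManifold (𝓡 n) ∞ M] (S : Spacetime n M) (hS : S.GloballyHyperbolic) :
    IsTopologicalBasis
        {O : Set S.IP | ∃ F : Set (Set S.IP), F.Finite ∧ F ⊆ S.subbasis ∧ O = ⋂₀ F} ∧
      T2Space S.IP ∧
      IsOpen S.PIPs ∧ Dense S.PIPs :=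
  ⟨S.isTopologicalBasis_finite_inter_subbasis, S.t2Space_IP, Spacetime.isOpen_PIPs hS.2,
    S.dense_PIPs⟩
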